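/- For a finite sequence $\mathbf{s}=(s_1,\dots,s_\ell)$ of positive integers with $s_1\ge 2$, let $$\zeta^\star(\mathbf{s})=\lim_{n\to\infty}\ \sum_{n\ge k_1\ge k_2\ge\cdots\ge k_\ell\ge 1}\ \prod_{i=1}^{\ell}\frac{1}{k_i^{s_i}}$$ denote the multiple zeta star value (the limit exists), and let $\{2\}^{a}$ denote the string consisting of $a$ copies of $2$. Write $\mathfrak{S}_N$ for the group of permutations of $\{1,\dots,N\}$. Let $r$ be a positive integer. (i) Let $e_1,\dots,e_{2r}$ be nonnegative integers and put $m=e_1+\cdots+e_{2r}$. Then $$\sum_{\tau\in\mathfrak{S}_{2r}}\zeta^\star\bigl(\{2\}^{e_{\tau(1)}},3,\{2\}^{e_{\tau(2)}},1,\{2\}^{e_{\tau(3)}},3,\{2\}^{e_{\tau(4)}},1,\dots,\{2\}^{e_{\tau(2r-1)}},3,\{2\}^{e_{\tau(2r)}},1\bigr)\in\mathbb{Q}\cdot\pi^{2m+4r}.$$ (ii) Let $e_1,\dots,e_{2r+1}$ be nonnegative integers and put $m=e_1+\cdots+e_{2r+1}$. Then $$\sum_{\tau\in\mathfrak{S}_{2r+1}}\zeta^\star\bigl(\{2\}^{e_{\tau(1)}},3,\{2\}^{e_{\tau(2)}},1,\dots,\{2\}^{e_{\tau(2r-1)}},3,\{2\}^{e_{\tau(2r)}},1,\{2\}^{e_{\tau(2r+1)}+1}\bigr)\in\mathbb{Q}\cdot\pi^{2m+4r+2}.$$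 -/

import Mathlib

open Filter Topology

/-- The multiple harmonic star sum of the composition `s = (s₁, …, s_ℓ)`:
the sum of `∏ i, 1 / kᵢ ^ sᵢ` over all `n ≥ k₁ ≥ k₂ ≥ … ≥ k_ℓ ≥ 1`.
For the empty composition it is `1` for all `n ≥ 0`. -/
noncomputable def harmonicStar (n : ℕ) (s : List ℕ) : ℝ :=
  ∑ k ∈ (Fintype.piFinset fun _ : Fin s.length => Finset.Icc 1 n).filter
      (fun k => ∀ i j : Fin s.length, i ≤ j → k j ≤ k i),
    ∏ i : Fin s.length, 1 / (k i : ℝ) ^ s.get i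

/-- The multiple zeta star value `ζ⋆(s)`: the limit of the multiple harmonic star sums.
It is meaningful only where that limit exists. -/
noncomputable def zetaStar (s : List ℕ) : ℝ :=
  limUnder atTop fun n : ℕ => harmonicStar n s

/-- The composition
`({2}^{c 0}, 3, {2}^{c 1}, 1, {2}^{c 2}, 3, {2}^{c 3}, 1, …, {2}^{c (2r-2)}, 3, {2}^{c (2r-1)}, 1)`
with `r` blocks. -/
def comp2321 (r : ℕ) (c : Fin (2 * r) → ℕ) : List ℕ :=
  (List.ofFn fun j : Fin r =>
    List.replicate (c ⟨2 * j.val, by omega⟩) 2 ++ [3] ++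
      List.replicate (c ⟨2 * j.val + 1, by omega⟩) 2 ++ [1]).flatten

/-- The composition
`({2}^{c 0}, 3, {2}^{c 1}, 1, …, {2}^{c (2r-2)}, 3, {2}^{c (2r-1)}, 1, {2}^{c (2r) + 1})`. -/
def comp2321Tail (r : ℕ) (c : Fin (2 * r + 1) → ℕ) : List ℕ :=
  comp2321 r (fun i => c i.castSucc) ++ List.replicate (c (Fin.last (2 * r)) + 1) 2

/-!
The star sums in question equal alternating sums with all exponents even, whose symmetrisations are
polynomials in the classical values `∑ (-1) ^ k / k ^ (2 * a)`.

*Star sums as alternating sums.* Let `w n k = C(n, k) / C(n + k, k)`. From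
`w n k - w (n - 1) k = (k / n) ^ 2 * w n k` and two telescoping identities one computes how an
expansion `H⋆ₙ(s) = ∑ₖ a k * w n k` changes when `2`, `1` or `3` is prepended to `s`. For `s` made of
the blocks `{2}^e, 3, {2}^f, 1`, possibly followed by `{2}^(e + 1)`, the coefficients turn out to be
`± (altSum L k - altSum L (k - 1))`, where `L` lists the numbers `e + 1` and `altSum L N` is the sum
over `N ≥ k₁ ≥ … ≥ k_ℓ ≥ 1` of `2 ^ #{k₁, …, k_ℓ} * ∏ i, (-1) ^ kᵢ / kᵢ ^ (2 * Lᵢ)`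
(`hasStarExpansion_comp2321`, `hasStarExpansion_comp2321Tail`). As `w n k → 1` for `n → ∞`, dominated
convergence gives `ζ⋆(s) = ± lim altSum L` (`HasStarExpansion.tendsto`).

*Symmetrisation.* The product `altSum [a] N * altSum L N` is the sum over all insertions of `a` into
`L`, minus the sum over all ways to merge two adjacent entries `x, y` of `L` into `x + a + y`
(`altSum_singleton_mul`). Summed over all rearrangements of `L`, this expresses the symmetric sum of
`a :: L` through `altSum [a]`, the symmetric sum of `L`, and symmetric sums of lists that are shorter
than `L` and have the same total as `a :: L` (`permSum_altSum_cons`). Merging three exponents keeps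
the sign `(-1) ^ k`, so no other kind of sum arises. Since `lim altSum [a]` is a rational multiple of
`π ^ (2 * a)` by Euler, induction on the length finishes the proof.
-/

open Finset


/-! ### Recursion for star sums -/

theorem harmonicStar_nil (n : ℕ) : harmonicStar n [] = 1 := by
  simp [harmonicStar]

theorem harmonicStar_cons (n s : ℕ) (t : List ℕ) :
    harmonicStar n (s :: t) = ∑ k ∈ Icc 1 n, 1 / (k : ℝ) ^ s * harmonicStar k t := by
  unfold harmonicStar
  simp_rw [mul_sum]
  rw [sum_sigma']
  refine sum_bij' (fun k _ => ⟨k 0, fun i : Fin t.length => k i.succ⟩)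
    (fun p _ => (Fin.cons p.1 p.2 : Fin (t.length + 1) → ℕ)) ?_ ?_ ?_ ?_ ?_
  · intro k hk
    simp only [mem_filter, Fintype.mem_piFinset, mem_sigma, mem_Icc] at hk ⊢
    exact ⟨hk.1 0, fun i => ⟨(hk.1 i.succ).1, hk.2 0 i.succ (Fin.zero_le _)⟩,
      fun i j hij => hk.2 _ _ (Fin.succ_le_succ_iff.2 hij)⟩
  · rintro ⟨m, k⟩ hk
    simp only [mem_filter, Fintype.mem_piFinset, mem_sigma, mem_Icc] at hk ⊢
    obtain ⟨hm, hk, hmono⟩ := hk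
    refine ⟨fun i => ?_, fun i j => ?_⟩
    · refine Fin.cases ?_ (fun i => ?_) i
      · simpa using hm
      · simpa using ⟨(hk i).1, (hk i).2.trans hm.2⟩
    · refine Fin.cases ?_ (fun i => ?_) i
      · refine Fin.cases ?_ (fun j => ?_) j
        · simp
        · intro _
          simpa using (hk j).2
      · refine Fin.cases ?_ (fun j => ?_) j
        · intro h
          exact absurd h (by simp)
        · intro h
          simpa using hmono i j (Fin.succ_le_succ_iff.1 h)
  · intro k _
    funext i
    refine Fin.cases ?_ (fun i => ?_) i <;> simp
  · rintro ⟨m, k⟩ _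
    simp
  · intro k _
    exact Fin.prod_univ_succ (n := t.length) _

/-! ### The weights -/

/-- The weight `C(n, k) / C(n + k, k)`, as a product; it vanishes for `k > n`. -/
noncomputable def starWeight (n k : ℕ) : ℝ :=
  ∏ i ∈ range k, ((n : ℝ) - i) / (n + i + 1)

theorem starWeight_zero (n : ℕ) : starWeight n 0 = 1 := by simp [starWeight]

theorem starWeight_succ (n k : ℕ) :
    ((n : ℝ) + (k + 1)) * starWeight n (k + 1) = (n - k) * starWeight n k := by
  have : (n : ℝ) + k + 1 ≠ 0 := by positivity
  rw [starWeight, prod_range_succ, ← starWeight]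
  field_simp
  ring

theorem starWeight_eq_zero {n k : ℕ} (h : n < k) : starWeight n k = 0 :=
  prod_eq_zero (mem_range.2 h) (by simp)

theorem starWeight_succ_left (n k : ℕ) :
    starWeight (n + 1) k * (((n : ℝ) + 1) ^ 2 - k ^ 2) = (n + 1) ^ 2 * starWeight n k := by
  induction k with
  | zero => simp [starWeight_zero]
  | succ k ih =>
    have h1 := starWeight_succ n k
    have h2 := starWeight_succ (n + 1) k
    have h3 : (n : ℝ) + (k + 1) ≠ 0 := by positivity
    push_cast at h1 h2 ⊢
    apply mul_left_cancel₀ h3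
    linear_combination (n + (k + 1)) * ((n : ℝ) - k) * h2 + (n - k) * ih - (n + 1) ^ 2 * h1

theorem starWeight_nonneg (n k : ℕ) : 0 ≤ starWeight n k := by
  rcases lt_or_ge n k with h | h
  · rw [starWeight_eq_zero h]
  · refine prod_nonneg fun i hi => div_nonneg ?_ (by positivity)
    have : i ≤ n := by have := mem_range.1 hi; omega
    exact sub_nonneg.2 (by exact_mod_cast this)

theorem starWeight_le_one (n k : ℕ) : starWeight n k ≤ 1 := by
  rcases lt_or_ge n k with h | h
  · rw [starWeight_eq_zero h]; exact zero_le_one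
  · refine prod_le_one (fun i hi => div_nonneg ?_ (by positivity)) fun i hi => ?_
    · have : i ≤ n := by have := mem_range.1 hi; omega
      exact sub_nonneg.2 (by exact_mod_cast this)
    · rw [div_le_one (by positivity)]
      linarith [(Nat.cast_nonneg i : (0 : ℝ) ≤ i)]

theorem tendsto_starWeight (k : ℕ) : Tendsto (fun n => starWeight n k) atTop (𝓝 1) := by
  have h : ∀ i ∈ range k,
      Tendsto (fun n : ℕ => ((n : ℝ) - i) / (n + i + 1)) atTop (𝓝 1) := fun i _ => by
    have h0 : Tendsto (fun n : ℕ => 1 - (2 * i + 1 : ℝ) / (n + (i + 1))) atTop (𝓝 (1 - 0)) :=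
      tendsto_const_nhds.sub (tendsto_const_nhds.div_atTop
        (tendsto_atTop_add_const_right _ _ tendsto_natCast_atTop_atTop))
    rw [sub_zero] at h0
    refine h0.congr fun n => ?_
    have : (n : ℝ) + i + 1 ≠ 0 := by positivity
    field_simp
    ring
  simpa [starWeight] using tendsto_finsetProd _ h

/-! ### Weighted expansions of star sums -/

/-- `s` has an expansion with partial sums `S` if
`H⋆ₙ(s) = ∑ₖ (S k - S (k - 1)) * C(n, k) / C(n + k, k)` for all `n ≥ 1`, the sum being over
`1 ≤ k ≤ n`. The coefficients are encoded by their partial sums, in which prepending an odd entry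
to `s` has a simple form. -/
def HasStarExpansion (s : List ℕ) (S : ℕ → ℝ) : Prop :=
  S 0 = 0 ∧ ∀ n : ℕ, harmonicStar (n + 1) s =
    ∑ k ∈ range (n + 1), (S (k + 1) - S k) * starWeight (n + 1) (k + 1)

/-- Since `w n k - w (n - 1) k = (k / n) ^ 2 * w n k` for the weights `w`, an expansion of the
`n`-th summand with coefficients `a k * k ^ 2` sums to one with coefficients `a k`. -/
theorem harmonicStar_cons_eq_of_summand {c : ℕ} {t : List ℕ} {a : ℕ → ℝ}
    (h : ∀ n : ℕ, 1 / ((n : ℝ) + 1) ^ c * harmonicStar (n + 1) t =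
      ∑ k ∈ range (n + 1), a k * (k + 1) ^ 2 / (n + 1) ^ 2 * starWeight (n + 1) (k + 1)) (n : ℕ) :
    harmonicStar n (c :: t) = ∑ k ∈ range n, a k * starWeight n (k + 1) := by
  induction n with
  | zero => simp [harmonicStar_cons]
  | succ n ih =>
    have h0 : harmonicStar (n + 1) (c :: t) = harmonicStar n (c :: t) +
        1 / ((n : ℝ) + 1) ^ c * harmonicStar (n + 1) t := by
      rw [harmonicStar_cons, harmonicStar_cons, sum_Icc_succ_top (by omega)]
      push_cast
      rfl
    have h1 : ∑ k ∈ range n, a k * starWeight n (k + 1) =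
        ∑ k ∈ range (n + 1), a k * starWeight n (k + 1) := by
      rw [sum_range_succ, starWeight_eq_zero n.lt_succ_self, mul_zero, add_zero]
    rw [h0, ih, h n, h1, ← sum_add_distrib]
    refine sum_congr rfl fun k _ => ?_
    have h2 := starWeight_succ_left n (k + 1)
    have h3 : (n : ℝ) + 1 ≠ 0 := by positivity
    push_cast at h2
    field_simp
    linear_combination (-a k) * h2

theorem HasStarExpansion.of_summand {c : ℕ} {t : List ℕ} {S : ℕ → ℝ} (h0 : S 0 = 0)
    (h : ∀ n : ℕ, 1 / ((n : ℝ) + 1) ^ c * harmonicStar (n + 1) t =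
      ∑ k ∈ range (n + 1),
        (S (k + 1) - S k) * (k + 1) ^ 2 / (n + 1) ^ 2 * starWeight (n + 1) (k + 1)) :
    HasStarExpansion (c :: t) S :=
  ⟨h0, fun n => harmonicStar_cons_eq_of_summand (a := fun k => S (k + 1) - S k) h (n + 1)⟩

theorem HasStarExpansion.cons_two {t : List ℕ} {S T : ℕ → ℝ} (h : HasStarExpansion t S)
    (hT0 : T 0 = 0)
    (hT : ∀ k : ℕ, T (k + 1) - T k = (S (k + 1) - S k) / (k + 1) ^ 2) :
    HasStarExpansion (2 :: t) T := by
  refine .of_summand hT0 fun n => ?_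
  rw [h.2, mul_sum]
  refine sum_congr rfl fun k _ => ?_
  rw [hT]
  field_simp

theorem HasStarExpansion.replicate_two {t : List ℕ} {S T : ℕ → ℝ} (h : HasStarExpansion t S)
    (e : ℕ) (hT0 : T 0 = 0)
    (hT : ∀ k : ℕ, T (k + 1) - T k = (S (k + 1) - S k) / (k + 1) ^ (2 * e)) :
    HasStarExpansion (List.replicate e 2 ++ t) T := by
  induction e generalizing T with
  | zero =>
    refine ⟨hT0, fun n => ?_⟩
    simp only [hT]
    simpa using h.2 n
  | succ e ih =>
    let U : ℕ → ℝ := fun n => ∑ k ∈ range n, (S (k + 1) - S k) / ((k : ℝ) + 1) ^ (2 * e)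
    have hU : ∀ k : ℕ, U (k + 1) - U k = (S (k + 1) - S k) / (k + 1) ^ (2 * e) := fun k => by
      simp [U, sum_range_succ]
    refine (ih (T := U) (by simp [U]) hU).cons_two hT0 fun k => ?_
    rw [hT, hU, div_div, ← pow_add]
    ring

/-- By `(n + k + 1) * w n (k + 1) = (n - k) * w n k`, the sum telescopes; the right-hand side
vanishes for `M = n`. -/
theorem sum_telescope_one {S : ℕ → ℝ} (h0 : S 0 = 0) (n M : ℕ) :
    ∑ k ∈ range M, (n * (S (k + 1) - S k) - (k + 1) * (S (k + 1) + S k)) * starWeight n (k + 1) =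
      S M * ((n - M) * starWeight n M) := by
  induction M with
  | zero => simp [h0]
  | succ M ih =>
    rw [sum_range_succ, ih, ← starWeight_succ]
    push_cast
    ring

/-- The alternating analogue of `sum_telescope_one`, with the roles of `n` and `k` exchanged. -/
theorem sum_telescope_three {S : ℕ → ℝ} (h0 : S 0 = 0) (n M : ℕ) :
    ∑ k ∈ range M, (-1 : ℝ) ^ (k + 1) *
      ((k + 1) * (S (k + 1) - S k) - n * (S (k + 1) + S k)) * starWeight n (k + 1) =
      -((-1) ^ M * (S M * ((n - M) * starWeight n M))) := by
  induction M with
  | zero => simp [h0]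
  | succ M ih =>
    rw [sum_range_succ, ih, ← starWeight_succ]
    push_cast
    ring

theorem HasStarExpansion.cons_one {t : List ℕ} {S T : ℕ → ℝ} (h : HasStarExpansion t S)
    (hT0 : T 0 = 0) (hT : ∀ k : ℕ, T (k + 1) - T k = (S (k + 1) + S k) / (k + 1)) :
    HasStarExpansion (1 :: t) T := by
  refine .of_summand hT0 fun n => ?_
  have key := sum_telescope_one h.1 (n + 1) (n + 1)
  have hn : (n : ℝ) + 1 ≠ 0 := by positivity
  rw [sub_self, zero_mul, mul_zero] at key
  rw [h.2, mul_sum, ← sub_eq_zero, ← sum_sub_distrib]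
  rw [← mul_right_inj' (pow_ne_zero 2 hn), mul_zero, ← key, mul_sum]
  refine sum_congr rfl fun k _ => ?_
  have hk : (k : ℝ) + 1 ≠ 0 := by positivity
  rw [hT]
  push_cast
  field_simp

theorem HasStarExpansion.cons_three {t : List ℕ} {B S T : ℕ → ℝ} (h : HasStarExpansion t B)
    (hS0 : S 0 = 0)
    (hB : ∀ k : ℕ, B (k + 1) - B k = (-1) ^ (k + 1) * ((k + 1) * (S (k + 1) - S k)))
    (hT0 : T 0 = 0)
    (hT : ∀ k : ℕ, T (k + 1) - T k = (-1) ^ (k + 1) * (S (k + 1) + S k) / (k + 1) ^ 2) :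
    HasStarExpansion (3 :: t) T := by
  refine .of_summand hT0 fun n => ?_
  have key := sum_telescope_three hS0 (n + 1) (n + 1)
  have hn : (n : ℝ) + 1 ≠ 0 := by positivity
  rw [sub_self, zero_mul, mul_zero, mul_zero, neg_zero] at key
  rw [h.2, mul_sum, ← sub_eq_zero, ← sum_sub_distrib]
  rw [← mul_right_inj' (pow_ne_zero 3 hn), mul_zero, ← key, mul_sum]
  refine sum_congr rfl fun k _ => ?_
  have hk : (k : ℝ) + 1 ≠ 0 := by positivity
  rw [hT, hB]
  push_cast
  field_simp

/-- The empty composition: `1 = 2 * ∑ₖ (-1) ^ (k - 1) * w n k` for `n ≥ 1`. -/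
theorem hasStarExpansion_nil : HasStarExpansion [] fun k => 1 - (-1) ^ k := by
  refine ⟨by simp, fun n => ?_⟩
  have key : ∀ M : ℕ, ∑ k ∈ range M, ((n + 1 : ℕ) : ℝ) *
      ((1 - (-1) ^ (k + 1) - (1 - (-1) ^ k)) * starWeight (n + 1) (k + 1)) =
      (n + 1) - (-1) ^ M * ((((n + 1 : ℕ) : ℝ) - M) * starWeight (n + 1) M) := fun M => by
    induction M with
    | zero => simp [starWeight_zero]
    | succ M ih =>
      rw [sum_range_succ, ih, ← starWeight_succ]
      push_cast
      ring
  have hn : ((n + 1 : ℕ) : ℝ) ≠ 0 := by positivity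
  rw [harmonicStar_nil, ← mul_right_inj' hn, mul_sum, key]
  push_cast
  ring

/-! ### Alternating sums -/

/-- The truncated alternating sum
`∑ 2 ^ #{k₁, …, k_ℓ} * ∏ i, (-1) ^ kᵢ / kᵢ ^ (2 * aᵢ)` over `N ≥ k₁ ≥ … ≥ k_ℓ ≥ 1`, for the list
`[a₁, …, a_ℓ]`. Fixing the largest index `k₁ = j + 1`, the remaining ones run up to `j + 1` or up
to `j`; adding both sums accounts for the power of `2`. -/
noncomputable def altSum : List ℕ → ℕ → ℝ
  | [], _ => 1
  | a :: L, N => ∑ j ∈ range N,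
      (-1) ^ (j + 1) / ((j : ℝ) + 1) ^ (2 * a) * (altSum L (j + 1) + altSum L j)

theorem altSum_nil (N : ℕ) : altSum [] N = 1 := rfl

theorem altSum_cons_zero (a : ℕ) (L : List ℕ) : altSum (a :: L) 0 = 0 := by simp [altSum]

theorem altSum_cons_succ (a : ℕ) (L : List ℕ) (N : ℕ) :
    altSum (a :: L) (N + 1) = altSum (a :: L) N +
      (-1) ^ (N + 1) / ((N : ℝ) + 1) ^ (2 * a) * (altSum L (N + 1) + altSum L N) := by
  simp only [altSum, sum_range_succ]

theorem altSum_singleton (a N : ℕ) :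
    altSum [a] N = 2 * ∑ j ∈ range N, (-1) ^ (j + 1) / ((j : ℝ) + 1) ^ (2 * a) := by
  simp only [altSum, mul_sum]
  refine sum_congr rfl fun j _ => ?_
  ring

/-! ### Star sums as weighted alternating sums -/

/-- Prepending `{2}^e, 3, {2}^f, 1` to `t` prepends the exponents `e + 1, f + 1`. The partial sums
of `t` enter only through `S (k + 1) + S k`; this is why `t = []` is covered, whose partial sums
`1 - (-1) ^ k` differ from `altSum [] k = 1`. -/
theorem HasStarExpansion.block {t L : List ℕ} {S : ℕ → ℝ} {ε : ℝ} (h : HasStarExpansion t S)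
    (hS : ∀ k, S (k + 1) + S k = ε * (altSum L (k + 1) + altSum L k)) (e f : ℕ) :
    HasStarExpansion (List.replicate e 2 ++ 3 :: (List.replicate f 2 ++ 1 :: t))
      fun k => ε * altSum ((e + 1) :: (f + 1) :: L) k := by
  let T₁ : ℕ → ℝ := fun n => ∑ k ∈ range n, (S (k + 1) + S k) / ((k : ℝ) + 1)
  let T₂ : ℕ → ℝ := fun n => ∑ k ∈ range n, (S (k + 1) + S k) / ((k : ℝ) + 1) ^ (2 * f + 1)
  let S₃ : ℕ → ℝ := fun n => ε * altSum ((f + 1) :: L) n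
  let T₃ : ℕ → ℝ := fun n => ∑ k ∈ range n,
    (-1) ^ (k + 1) * (S₃ (k + 1) + S₃ k) / ((k : ℝ) + 1) ^ 2
  have h₁ : HasStarExpansion (1 :: t) T₁ :=
    h.cons_one (by simp [T₁]) fun k => by simp [T₁, sum_range_succ]
  have h₂ : HasStarExpansion (List.replicate f 2 ++ 1 :: t) T₂ := by
    refine h₁.replicate_two f (by simp [T₂]) fun k => ?_
    simp only [T₁, T₂, sum_range_succ, add_sub_cancel_left]
    rw [div_div, ← pow_succ']
  have h₃ : HasStarExpansion (3 :: (List.replicate f 2 ++ 1 :: t)) T₃ := by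
    refine h₂.cons_three (S := S₃) (by simp [S₃, altSum_cons_zero]) (fun k => ?_) (by simp [T₃])
      fun k => by simp [T₃, sum_range_succ]
    simp only [T₂, S₃, sum_range_succ, add_sub_cancel_left, altSum_cons_succ, hS]
    have hk : (k : ℝ) + 1 ≠ 0 := by positivity
    have h1 : ((-1 : ℝ) ^ (k + 1)) ^ 2 = 1 := by rw [← pow_mul, mul_comm, pow_mul]; simp
    rw [show 2 * (f + 1) = 2 * f + 1 + 1 by ring, pow_succ _ (2 * f + 1)]
    field_simp
    linear_combination (-ε * (altSum L (k + 1) + altSum L k)) * h1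
  refine h₃.replicate_two e (by simp [altSum_cons_zero]) fun k => ?_
  simp only [T₃, S₃, sum_range_succ, add_sub_cancel_left]
  rw [altSum_cons_succ]
  field_simp
  ring

/-- The composition `{2}^(e + 1)`. -/
theorem hasStarExpansion_replicate_two (e : ℕ) :
    HasStarExpansion (List.replicate (e + 1) 2) fun k => -1 * altSum [e + 1] k := by
  have h := hasStarExpansion_nil.replicate_two (T := fun k => -1 * altSum [e + 1] k) (e + 1)
    (by simp [altSum_cons_zero]) fun k => by
      simp only [altSum_cons_succ, altSum_nil]
      ring
  simpa using h

theorem comp2321_zero (c : Fin (2 * 0) → ℕ) : comp2321 0 c = [] := by simp [comp2321]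

theorem comp2321_succ (r : ℕ) (c : Fin (2 * (r + 1)) → ℕ) :
    comp2321 (r + 1) c = List.replicate (c ⟨0, by omega⟩) 2 ++
      3 :: (List.replicate (c ⟨1, by omega⟩) 2 ++
        1 :: comp2321 r fun i => c ⟨i + 2, by omega⟩) := by
  simp [comp2321, List.ofFn_succ, mul_add]

theorem ofFn_two_mul_succ (r : ℕ) (c : Fin (2 * (r + 1)) → ℕ) :
    List.ofFn c = c ⟨0, by omega⟩ :: c ⟨1, by omega⟩ ::
      List.ofFn fun i : Fin (2 * r) => c ⟨i + 2, by omega⟩ := by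
  change List.ofFn (n := 2 * r + 1 + 1) c = _
  rw [List.ofFn_succ, List.ofFn_succ]
  rfl

theorem exists_hasStarExpansion_comp2321_append {t L : List ℕ} {S : ℕ → ℝ} {ε : ℝ}
    (h : HasStarExpansion t S)
    (hS : ∀ k, S (k + 1) + S k = ε * (altSum L (k + 1) + altSum L k)) (r : ℕ)
    (c : Fin (2 * r) → ℕ) :
    ∃ T : ℕ → ℝ, HasStarExpansion (comp2321 r c ++ t) T ∧ ∀ k, T (k + 1) + T k =
      ε * (altSum (List.ofFn (fun i => c i + 1) ++ L) (k + 1) +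
        altSum (List.ofFn (fun i => c i + 1) ++ L) k) := by
  induction r with
  | zero => exact ⟨S, by simpa [comp2321_zero] using h, by simpa using hS⟩
  | succ r ih =>
    obtain ⟨T, hT, hT'⟩ := ih fun i => c ⟨i + 2, by omega⟩
    refine ⟨fun k => ε * altSum (List.ofFn (fun i => c i + 1) ++ L) k, ?_,
      fun k => (mul_add ε _ _).symm⟩
    rw [comp2321_succ, ofFn_two_mul_succ]
    simpa using hT.block hT' (c ⟨0, by omega⟩) (c ⟨1, by omega⟩)

/-- With at least one block, the partial sums themselves are known. -/
theorem hasStarExpansion_comp2321_append {t L : List ℕ} {S : ℕ → ℝ} {ε : ℝ}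
    (h : HasStarExpansion t S)
    (hS : ∀ k, S (k + 1) + S k = ε * (altSum L (k + 1) + altSum L k)) {r : ℕ} (hr : 0 < r)
    (c : Fin (2 * r) → ℕ) :
    HasStarExpansion (comp2321 r c ++ t)
      fun k => ε * altSum (List.ofFn (fun i => c i + 1) ++ L) k := by
  obtain ⟨r, rfl⟩ := Nat.exists_eq_add_of_le' hr
  obtain ⟨T, hT, hT'⟩ := exists_hasStarExpansion_comp2321_append h hS r fun i => c ⟨i + 2, by omega⟩
  have := hT.block hT' (c ⟨0, by omega⟩) (c ⟨1, by omega⟩)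
  rw [comp2321_succ, ofFn_two_mul_succ]
  simpa using this

theorem hasStarExpansion_comp2321 {r : ℕ} (hr : 0 < r) (c : Fin (2 * r) → ℕ) :
    HasStarExpansion (comp2321 r c) fun k => 1 * altSum (List.ofFn fun i => c i + 1) k := by
  have h := hasStarExpansion_comp2321_append (L := []) (ε := 1) hasStarExpansion_nil
    (fun k => by simp only [altSum_nil]; ring) hr c
  simpa using h

theorem hasStarExpansion_comp2321Tail {r : ℕ} (hr : 0 < r) (c : Fin (2 * r + 1) → ℕ) :
    HasStarExpansion (comp2321Tail r c)
      fun k => -1 * altSum (List.ofFn fun i => c i + 1) k := by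
  have h := hasStarExpansion_comp2321_append (L := [c (Fin.last _) + 1]) (ε := -1)
    (hasStarExpansion_replicate_two (c (Fin.last _))) (fun k => by ring) hr fun i => c i.castSucc
  rw [List.ofFn_succ']
  simpa [comp2321Tail] using h

/-! ### Passage to the limit -/

theorem summable_and_tendsto_altSum : ∀ L : List ℕ, (∀ a ∈ L, 1 ≤ a) →
    Summable (fun k => |altSum L (k + 1) - altSum L k|) ∧ ∃ x, Tendsto (altSum L) atTop (𝓝 x)
  | [], _ => ⟨by simp [altSum_nil], 1, tendsto_const_nhds⟩
  | a :: L, h => by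
    obtain ⟨-, x, hx⟩ := summable_and_tendsto_altSum L fun b hb => h b (List.mem_cons_of_mem _ hb)
    obtain ⟨C, hC⟩ := (Metric.isBounded_range_of_tendsto _ hx).exists_norm_le
    have hC' : ∀ n, |altSum L n| ≤ C := fun n => hC _ ⟨n, rfl⟩
    have h2 : Summable fun k : ℕ => 1 / ((k : ℝ) + 1) ^ 2 := by
      simpa using (summable_nat_add_iff 1).2 (Real.summable_one_div_nat_pow.2 one_lt_two)
    have hs : Summable fun k => |altSum (a :: L) (k + 1) - altSum (a :: L) k| := by
      refine Summable.of_nonneg_of_le (fun _ => abs_nonneg _) (fun k => ?_) (h2.mul_right (C + C))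
      rw [altSum_cons_succ, add_sub_cancel_left, abs_mul, abs_div, abs_pow, abs_neg, abs_one,
        one_pow, abs_of_pos (by positivity : (0 : ℝ) < ((k : ℝ) + 1) ^ (2 * a))]
      have ha : 2 ≤ 2 * a := by have := h a List.mem_cons_self; omega
      gcongr
      · linarith [(k.cast_nonneg : (0 : ℝ) ≤ k)]
      · exact (abs_add_le _ _).trans (add_le_add (hC' _) (hC' _))
    have ht := hs.of_abs.hasSum.tendsto_sum_nat
    simp only [sum_range_sub, altSum_cons_zero, sub_zero] at ht
    exact ⟨hs, _, ht⟩

/-- Each weight tends to `1`, so dominated convergence applies. -/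
theorem HasStarExpansion.tendsto {s L : List ℕ} {ε x : ℝ}
    (h : HasStarExpansion s fun k => ε * altSum L k) (hL : ∀ a ∈ L, 1 ≤ a)
    (hx : Tendsto (altSum L) atTop (𝓝 x)) :
    Tendsto (fun n => harmonicStar n s) atTop (𝓝 (ε * x)) := by
  have hs := (summable_and_tendsto_altSum L hL).1
  have hsum : HasSum (fun k => altSum L (k + 1) - altSum L k) (x - altSum L 0) := by
    rw [hs.of_abs.hasSum_iff_tendsto_nat]
    simpa only [sum_range_sub] using hx.sub_const _
  have key := tendsto_tsum_of_dominated_convergence (𝓕 := atTop)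
    (f := fun n k => (altSum L (k + 1) - altSum L k) * starWeight n (k + 1))
    (g := fun k => altSum L (k + 1) - altSum L k) hs
    (fun k => by simpa using (tendsto_starWeight (k + 1)).const_mul _)
    (Eventually.of_forall fun n k => by
      rw [norm_mul, Real.norm_eq_abs, Real.norm_of_nonneg (starWeight_nonneg _ _)]
      exact mul_le_of_le_one_right (abs_nonneg _) (starWeight_le_one _ _))
  rw [hsum.tsum_eq] at key
  have key := key.const_mul ε
  rw [mul_sub, show ε * altSum L 0 = 0 from h.1, sub_zero] at key
  refine key.congr' ?_
  filter_upwards [eventually_ge_atTop 1] with n hn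
  obtain ⟨n, rfl⟩ := Nat.exists_eq_add_of_le' hn
  rw [h.2, tsum_eq_sum (s := range (n + 1)), mul_sum]
  · exact sum_congr rfl fun k _ => by ring
  · intro k hk
    rw [starWeight_eq_zero, mul_zero]
    simp at hk
    omega

/-! ### Sums over insertions, mergers and permutations -/

/-- Sum of `φ` over the lists obtained by inserting `x` somewhere. -/
def insertSum (x : ℕ) : (List ℕ → ℝ) → List ℕ → ℝ
  | φ, [] => φ [x]
  | φ, y :: t => φ (x :: y :: t) + insertSum x (fun l => φ (y :: l)) t

/-- Sum of `φ` over the lists obtained by replacing two adjacent entries `x, y` by `x + a + y`. -/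
def mergeSum (a : ℕ) : (List ℕ → ℝ) → List ℕ → ℝ
  | φ, x :: y :: t => φ ((x + a + y) :: t) + mergeSum a (fun l => φ (x :: l)) (y :: t)
  | _, _ => 0

/-- Sum of `φ` over the lists obtained by adding `c` to one entry. -/
def bumpSum (c : ℕ) : (List ℕ → ℝ) → List ℕ → ℝ
  | _, [] => 0
  | φ, y :: t => φ ((c + y) :: t) + bumpSum c (fun l => φ (y :: l)) t

/-- Sum of `φ` over the rearrangements of a list, counted with multiplicity. -/
def permSum : (List ℕ → ℝ) → List ℕ → ℝ
  | φ, [] => φ []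
  | φ, x :: L => permSum (insertSum x φ) L

/-- Sum of `φ` over the lists obtained by merging two entries `x, y`, not necessarily adjacent, into
`x + a + y`, over all ordered pairs of positions. -/
def pairSum (a : ℕ) : (List ℕ → ℝ) → List ℕ → ℝ
  | _, [] => 0
  | φ, x :: L => pairSum a (fun l => φ (x :: l)) L + 2 * bumpSum (x + a) φ L

theorem insertSum_add (x : ℕ) (φ ψ : List ℕ → ℝ) (L : List ℕ) :
    insertSum x (fun l => φ l + ψ l) L = insertSum x φ L + insertSum x ψ L := by
  induction L generalizing φ ψ with
  | nil => rfl
  | cons y t ih => simp only [insertSum, ih]; ring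

theorem mergeSum_add (a : ℕ) (φ ψ : List ℕ → ℝ) (L : List ℕ) :
    mergeSum a (fun l => φ l + ψ l) L = mergeSum a φ L + mergeSum a ψ L := by
  induction L generalizing φ ψ with
  | nil => simp [mergeSum]
  | cons x t ih =>
    cases t with
    | nil => simp [mergeSum]
    | cons y t => simp only [mergeSum, ih]; ring

theorem bumpSum_add (c : ℕ) (φ ψ : List ℕ → ℝ) (L : List ℕ) :
    bumpSum c (fun l => φ l + ψ l) L = bumpSum c φ L + bumpSum c ψ L := by
  induction L generalizing φ ψ with
  | nil => simp [bumpSum]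
  | cons x t ih => simp only [bumpSum, ih]; ring

theorem insertSum_const_mul (x : ℕ) (c : ℝ) (φ : List ℕ → ℝ) (L : List ℕ) :
    insertSum x (fun l => c * φ l) L = c * insertSum x φ L := by
  induction L generalizing φ with
  | nil => rfl
  | cons y t ih => simp only [insertSum, ih]; ring

theorem mergeSum_const_mul (a : ℕ) (c : ℝ) (φ : List ℕ → ℝ) (L : List ℕ) :
    mergeSum a (fun l => c * φ l) L = c * mergeSum a φ L := by
  induction L generalizing φ with
  | nil => simp [mergeSum]
  | cons x t ih =>
    cases t with
    | nil => simp [mergeSum]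
    | cons y t => simp only [mergeSum, ih]; ring

theorem permSum_add (φ ψ : List ℕ → ℝ) (L : List ℕ) :
    permSum (fun l => φ l + ψ l) L = permSum φ L + permSum ψ L := by
  induction L generalizing φ ψ with
  | nil => rfl
  | cons y t ih =>
    simp only [permSum, ← ih]
    congr 1
    funext l
    exact insertSum_add _ _ _ _

theorem permSum_const_mul (c : ℝ) (φ : List ℕ → ℝ) (L : List ℕ) :
    permSum (fun l => c * φ l) L = c * permSum φ L := by
  induction L generalizing φ with
  | nil => rfl
  | cons y t ih =>
    simp only [permSum, ← ih]
    congr 1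
    funext l
    exact insertSum_const_mul _ _ _ _

/-- After inserting `x`, the entry that is increased is either `x` or an old one. -/
theorem insertSum_bumpSum (c x : ℕ) (φ : List ℕ → ℝ) (L : List ℕ) :
    insertSum x (bumpSum c φ) L = insertSum (c + x) φ L + bumpSum c (insertSum x φ) L := by
  induction L generalizing φ with
  | nil => simp [insertSum, bumpSum]
  | cons y t ih =>
    simp only [insertSum, bumpSum, insertSum_add, bumpSum_add, ih]
    ring

theorem permSum_bumpSum (c : ℕ) (φ : List ℕ → ℝ) (L : List ℕ) :
    permSum (bumpSum c φ) L = bumpSum c (permSum φ) L := by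
  induction L generalizing φ with
  | nil => rfl
  | cons x t ih =>
    have h : insertSum x (bumpSum c φ) =
        fun l => insertSum (c + x) φ l + bumpSum c (insertSum x φ) l :=
      funext fun l => insertSum_bumpSum c x φ l
    simp only [permSum, bumpSum]
    rw [h, permSum_add, ih]

/-- After inserting `x`, a merger either involves `x`, in which case it adds to one entry, or
commutes with the insertion. -/
theorem insertSum_mergeSum (a x : ℕ) (φ : List ℕ → ℝ) (L : List ℕ) :
    insertSum x (mergeSum a φ) L = mergeSum a (insertSum x φ) L + 2 * bumpSum (x + a) φ L := by
  induction L generalizing φ with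
  | nil => simp [insertSum, bumpSum, mergeSum]
  | cons y t ih =>
    cases t with
    | nil =>
      simp only [insertSum, bumpSum, mergeSum]
      rw [show y + a + x = x + a + y by ring]
      ring
    | cons z t =>
      have h := ih fun l => φ (y :: l)
      simp only [insertSum, bumpSum, mergeSum, insertSum_add, mergeSum_add] at h ⊢
      rw [show y + a + x = x + a + y by ring]
      linear_combination h

theorem permSum_mergeSum (a : ℕ) (φ : List ℕ → ℝ) (L : List ℕ) :
    permSum (mergeSum a φ) L = pairSum a (permSum φ) L := by
  induction L generalizing φ with
  | nil => simp [permSum, mergeSum, pairSum]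
  | cons x t ih =>
    have h : insertSum x (mergeSum a φ) =
        fun l => mergeSum a (insertSum x φ) l + 2 * bumpSum (x + a) φ l :=
      funext fun l => insertSum_mergeSum a x φ l
    simp only [permSum, pairSum]
    rw [h, permSum_add, permSum_const_mul, permSum_bumpSum, ih]

theorem insertSum_eq_sum_map (x : ℕ) (φ : List ℕ → ℝ) (L : List ℕ) :
    insertSum x φ L = ((L.permutations'Aux x).map φ).sum := by
  induction L generalizing φ with
  | nil => simp [insertSum]
  | cons y t ih => simp [insertSum, ih, Function.comp_def]

theorem permSum_eq_sum_map (φ : List ℕ → ℝ) (L : List ℕ) :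
    permSum φ L = (L.permutations'.map φ).sum := by
  induction L generalizing φ with
  | nil => simp [permSum]
  | cons x t ih =>
    rw [permSum, ih, List.permutations', List.map_flatMap, List.flatMap_def, List.sum_flatten,
      List.map_map]
    congr 2
    funext l
    exact insertSum_eq_sum_map x φ l

/-- The list of indices `0, …, n - 1` has distinct entries, so its rearrangements are exactly the
permutations of `Fin n`. -/
theorem sum_perm_ofFn (n : ℕ) (e : Fin n → ℕ) (φ : List ℕ → ℝ) :
    ∑ τ : Equiv.Perm (Fin n), φ (List.ofFn fun i => e (τ i)) = permSum φ (List.ofFn e) := by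
  classical
  have hnd : (List.finRange n).permutations'.Nodup :=
    (List.permutations_perm_permutations' _).nodup_iff.1
      (List.nodup_permutations _ (List.nodup_finRange n))
  rw [permSum_eq_sum_map, List.ofFn_eq_map, ← List.map_permutations', List.map_map,
    ← List.sum_toFinset _ hnd]
  refine sum_bij (fun τ _ => List.ofFn τ) (fun τ _ => ?_) (fun τ _ σ _ h => ?_) (fun l hl => ?_)
    fun τ _ => ?_
  · rw [List.mem_toFinset, List.mem_permutations', ← List.ofFn_id]
    exact τ.ofFn_comp_perm id
  · exact DFunLike.coe_injective (List.ofFn_injective h)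
  · rw [List.mem_toFinset, List.mem_permutations'] at hl
    have hn : l.length = n := by simpa using hl.length_eq
    obtain ⟨f, rfl⟩ : ∃ f : Fin n → Fin n, List.ofFn f = l :=
      ⟨fun i => l.get (i.cast hn.symm), List.ext_get (by simp [hn]) fun i _ _ => by simp⟩
    have hinj : Function.Injective f :=
      List.nodup_ofFn.1 (hl.nodup_iff.2 (List.nodup_finRange n))
    exact ⟨Equiv.ofBijective f (Finite.injective_iff_bijective.1 hinj), mem_univ _, rfl⟩
  · simp [List.ofFn_eq_map, Function.comp_def]

/-! ### The product formula -/

/-- Writing the weight of an alternating sum as `2 ^ #{k₁, …, k_ℓ}`: inserting a new index `k` with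
a value different from all others multiplies it by `2`. If `k` coincides with `m ≥ 1` equal indices,
there are `m + 1` ways to insert it and `m - 1` mergers, hence a difference of `2` as well. -/
theorem altSum_singleton_mul (a : ℕ) (p : List ℕ) (N : ℕ) :
    altSum [a] N * altSum p N =
      insertSum a (fun l => altSum l N) p - mergeSum a (fun l => altSum l N) p := by
  induction p generalizing N with
  | nil => simp [insertSum, mergeSum, altSum_nil]
  | cons x t ih =>
    have hi : ∀ N, insertSum a (fun l => altSum (x :: l) (N + 1)) t =
        insertSum a (fun l => altSum (x :: l) N) t + (-1) ^ (N + 1) / ((N : ℝ) + 1) ^ (2 * x) *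
          (insertSum a (fun l => altSum l (N + 1)) t + insertSum a (fun l => altSum l N) t) := by
      intro N
      simp only [altSum_cons_succ, insertSum_add, insertSum_const_mul]
    have hm : ∀ N, mergeSum a (fun l => altSum (x :: l) (N + 1)) t =
        mergeSum a (fun l => altSum (x :: l) N) t + (-1) ^ (N + 1) / ((N : ℝ) + 1) ^ (2 * x) *
          (mergeSum a (fun l => altSum l (N + 1)) t + mergeSum a (fun l => altSum l N) t) := by
      intro N
      simp only [altSum_cons_succ, mergeSum_add, mergeSum_const_mul]
    -- the mergers of `x :: t` that involve `x`
    obtain ⟨u, hu0, hu, hm'⟩ : ∃ u : ℕ → ℝ, u 0 = 0 ∧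
        (∀ N, u (N + 1) = u N + (-1) ^ (N + 1) / ((N : ℝ) + 1) ^ (2 * x) *
          ((-1) ^ (N + 1) / ((N : ℝ) + 1) ^ (2 * a)) * (altSum t (N + 1) - altSum t N)) ∧
        ∀ N, mergeSum a (fun l => altSum l N) (x :: t) =
          u N + mergeSum a (fun l => altSum (x :: l) N) t := by
      cases t with
      | nil => exact ⟨fun _ => 0, rfl, by simp [altSum_nil], by simp [mergeSum]⟩
      | cons y t =>
        refine ⟨fun N => altSum ((x + a + y) :: t) N, altSum_cons_zero _ _, fun N => ?_,
          fun N => rfl⟩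
        have h1 : ((-1 : ℝ) ^ (N + 1)) ^ 2 = 1 := by rw [← pow_mul, mul_comm, pow_mul]; simp
        simp only [altSum_cons_succ]
        generalize (-1 : ℝ) ^ (N + 1) = s at h1 ⊢
        linear_combination (-(s / ((N : ℝ) + 1) ^ (2 * (x + a + y)) *
          (altSum t (N + 1) + altSum t N))) * h1
    induction N with
    | zero =>
      have h1 := insertSum_const_mul a 0 (fun _ => 0) t
      have h2 := mergeSum_const_mul a 0 (fun _ => 0) t
      simp only [zero_mul] at h1 h2
      simp [insertSum, hm', hu0, altSum_cons_zero, h1, h2]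
    | succ N ihN =>
      have e1 := ih N
      have e2 := ih (N + 1)
      rw [hm'] at ihN ⊢
      simp only [insertSum] at ihN ⊢
      rw [hi, hm, hu, altSum_cons_succ a (x :: t), altSum_cons_succ x t]
      rw [altSum_cons_succ a [], altSum_nil, altSum_nil] at e2 ⊢
      linear_combination ihN + (-1) ^ (N + 1) / ((N : ℝ) + 1) ^ (2 * x) * (e1 + e2)

theorem permSum_altSum_cons (a : ℕ) (L : List ℕ) (N : ℕ) :
    permSum (fun l => altSum l N) (a :: L) =
      altSum [a] N * permSum (fun l => altSum l N) L +
        pairSum a (permSum fun l => altSum l N) L := by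
  rw [← permSum_const_mul, ← permSum_mergeSum, ← permSum_add, permSum]
  congr 1
  funext l
  rw [altSum_singleton_mul]
  ring

/-! ### Rationality -/

/-- The sequence `u` converges to a rational multiple of `π ^ w`. -/
def TendstoRatMulPiPow (u : ℕ → ℝ) (w : ℕ) : Prop :=
  ∃ q : ℚ, Tendsto u atTop (𝓝 (q * Real.pi ^ w))

theorem TendstoRatMulPiPow.add {u v : ℕ → ℝ} {w : ℕ} (hu : TendstoRatMulPiPow u w)
    (hv : TendstoRatMulPiPow v w) : TendstoRatMulPiPow (fun n => u n + v n) w := by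
  obtain ⟨p, hp⟩ := hu
  obtain ⟨q, hq⟩ := hv
  exact ⟨p + q, by simpa [add_mul] using hp.add hq⟩

theorem TendstoRatMulPiPow.mul {u v : ℕ → ℝ} {w x : ℕ} (hu : TendstoRatMulPiPow u w)
    (hv : TendstoRatMulPiPow v x) : TendstoRatMulPiPow (fun n => u n * v n) (w + x) := by
  obtain ⟨p, hp⟩ := hu
  obtain ⟨q, hq⟩ := hv
  refine ⟨p * q, ?_⟩
  convert hp.mul hq using 2
  push_cast
  ring

theorem TendstoRatMulPiPow.const_mul {u : ℕ → ℝ} {w : ℕ} (hu : TendstoRatMulPiPow u w) (c : ℚ) :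
    TendstoRatMulPiPow (fun n => c * u n) w := by
  obtain ⟨p, hp⟩ := hu
  exact ⟨c * p, by simpa [mul_assoc] using hp.const_mul (c : ℝ)⟩

theorem tendstoRatMulPiPow_zero (w : ℕ) : TendstoRatMulPiPow (fun _ => 0) w :=
  ⟨0, by simp⟩

/-- Euler's evaluation: `∑ (-1) ^ k / k ^ (2 * a)` is the Fourier series of a Bernoulli polynomial
at `1 / 2`. -/
theorem tendstoRatMulPiPow_altSum_singleton {a : ℕ} (ha : 1 ≤ a) :
    TendstoRatMulPiPow (altSum [a]) (2 * a) := by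
  have h := hasSum_one_div_nat_pow_mul_cos (k := a) (by omega) (x := 1 / 2) (by norm_num)
  have hB : (Polynomial.map (algebraMap ℚ ℝ) (Polynomial.bernoulli (2 * a))).eval (1 / 2) =
      (((Polynomial.bernoulli (2 * a)).eval (1 / 2) : ℚ) : ℝ) := by
    have := Polynomial.eval_map_apply (p := Polynomial.bernoulli (2 * a)) (algebraMap ℚ ℝ) (1 / 2)
    simpa using this
  have hcos : ∀ n : ℕ, Real.cos (2 * Real.pi * n * (1 / 2)) = (-1) ^ n := fun n => by
    rw [← Real.cos_nat_mul_pi]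
    congr 1
    ring
  simp only [hB, hcos] at h
  refine ⟨2 * ((-1) ^ (a + 1) * 2 ^ (2 * a) / 2 / (2 * a).factorial *
    (Polynomial.bernoulli (2 * a)).eval (1 / 2)), ?_⟩
  have ht := ((h.tendsto_sum_nat.comp (tendsto_add_atTop_nat 1)).const_mul 2)
  convert ht using 1
  · funext N
    have h0 : ((0 : ℕ) : ℝ) ^ (2 * a) = 0 := by simp; omega
    rw [altSum_singleton, Function.comp_apply, sum_range_succ', h0]
    push_cast
    simp [div_eq_inv_mul]
  · push_cast
    congr 1
    ring

theorem tendstoRatMulPiPow_bumpSum {φ : List ℕ → ℕ → ℝ} {w c : ℕ} {L : List ℕ}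
    (hL : ∀ b ∈ L, 1 ≤ b)
    (h : ∀ l : List ℕ, l.length = L.length → l.sum = c + L.sum → (∀ b ∈ l, 1 ≤ b) →
      TendstoRatMulPiPow (φ l) w) :
    TendstoRatMulPiPow (fun N => bumpSum c (fun l => φ l N) L) w := by
  induction L generalizing φ with
  | nil => exact tendstoRatMulPiPow_zero w
  | cons y t ih =>
    obtain ⟨hy, ht⟩ := List.forall_mem_cons.1 hL
    refine (h ((c + y) :: t) rfl (by simp [add_assoc]) (List.forall_mem_cons.2 ⟨by omega, ht⟩)).add
      (ih (φ := fun l => φ (y :: l)) ht fun l h1 h2 h3 => h _ (by simp [h1]) ?_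
        (List.forall_mem_cons.2 ⟨hy, h3⟩))
    rw [List.sum_cons, List.sum_cons, h2]
    ring

theorem tendstoRatMulPiPow_pairSum {φ : List ℕ → ℕ → ℝ} {w a : ℕ} {L : List ℕ}
    (hL : ∀ b ∈ L, 1 ≤ b)
    (h : ∀ l : List ℕ, l.length + 1 = L.length → l.sum = a + L.sum → (∀ b ∈ l, 1 ≤ b) →
      TendstoRatMulPiPow (φ l) w) :
    TendstoRatMulPiPow (fun N => pairSum a (fun l => φ l N) L) w := by
  induction L generalizing φ with
  | nil => exact tendstoRatMulPiPow_zero w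
  | cons x t ih =>
    obtain ⟨hx, ht⟩ := List.forall_mem_cons.1 hL
    have h1 := ih (φ := fun l => φ (x :: l)) ht fun l h1 h2 h3 => h _ (by simp [h1])
      (by rw [List.sum_cons, List.sum_cons, h2]; ring) (List.forall_mem_cons.2 ⟨hx, h3⟩)
    have h2 := tendstoRatMulPiPow_bumpSum (φ := φ) (w := w) (c := x + a) ht fun l h1 h2 h3 =>
      h l (by simp [h1]) (by rw [List.sum_cons, h2]; ring) h3
    simpa [pairSum] using h1.add (h2.const_mul 2)

/-- By induction on the length: the symmetrised product formula expresses the symmetric sum of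
`a :: L` through the one of `L` and those of shorter lists with the same total. -/
theorem tendstoRatMulPiPow_permSum_altSum (L : List ℕ) (hL : ∀ b ∈ L, 1 ≤ b) :
    TendstoRatMulPiPow (fun N => permSum (fun l => altSum l N) L) (2 * L.sum) := by
  induction hn : L.length using Nat.strong_induction_on generalizing L with
  | _ n ih =>
    subst hn
    cases L with
    | nil => exact ⟨1, by simp [permSum, altSum_nil]⟩
    | cons a L =>
      obtain ⟨ha, hL⟩ := List.forall_mem_cons.1 hL
      have h1 := (tendstoRatMulPiPow_altSum_singleton ha).mul (ih L.length (by simp) L hL rfl)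
      rw [← mul_add, ← List.sum_cons] at h1
      have h2 := tendstoRatMulPiPow_pairSum (a := a) (w := 2 * (a :: L).sum)
        (φ := fun l N => permSum (fun l => altSum l N) l) hL fun l hl hs hp => by
          rw [List.sum_cons, ← hs]
          exact ih l.length (by rw [List.length_cons]; omega) l hp rfl
      simpa only [permSum_altSum_cons] using h1.add h2

/-! ### Symmetric sums of multiple zeta star values -/

theorem one_le_of_mem_ofFn_add_one {n : ℕ} {c : Fin n → ℕ} :
    ∀ a ∈ List.ofFn fun i => c i + 1, 1 ≤ a := fun a ha => by
  obtain ⟨i, rfl⟩ := (List.mem_ofFn' _ _).1 ha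
  exact Nat.le_add_left 1 _

theorem HasStarExpansion.tendsto_zetaStar {s L : List ℕ} {ε : ℝ}
    (h : HasStarExpansion s fun k => ε * altSum L k) (hL : ∀ a ∈ L, 1 ≤ a) :
    Tendsto (fun n => harmonicStar n s) atTop (𝓝 (zetaStar s)) := by
  obtain ⟨x, hx⟩ := (summable_and_tendsto_altSum L hL).2
  exact tendsto_nhds_limUnder ⟨_, h.tendsto hL hx⟩

/-- If the composition `s c` has the expansion given by alternating sums with exponents `c i + 1`,
then its symmetrised zeta star values are rational multiples of a power of `π`. -/
theorem exists_rat_sum_perm_zetaStar {n : ℕ} {s : (Fin n → ℕ) → List ℕ} {ε : ℚ}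
    (h : ∀ c, HasStarExpansion (s c) fun k => ε * altSum (List.ofFn fun i => c i + 1) k)
    (e : Fin n → ℕ) :
    ∃ q : ℚ, ∑ τ : Equiv.Perm (Fin n), zetaStar (s fun i => e (τ i)) =
      q * Real.pi ^ (2 * (∑ i, e i) + 2 * n) := by
  have hpos : ∀ c : Fin n → ℕ, ∀ a ∈ List.ofFn fun i => c i + 1, 1 ≤ a := fun _ =>
    one_le_of_mem_ofFn_add_one
  choose x hx using fun c => (summable_and_tendsto_altSum _ (hpos c)).2
  have hz : ∀ c, zetaStar (s c) = ε * x c := fun c =>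
    tendsto_nhds_unique ((h c).tendsto_zetaStar (hpos c)) ((h c).tendsto (hpos c) (hx c))
  obtain ⟨q, hq⟩ := tendstoRatMulPiPow_permSum_altSum _ (hpos e)
  have hsum : Tendsto (fun N => ∑ τ : Equiv.Perm (Fin n),
      altSum (List.ofFn fun i => e (τ i) + 1) N) atTop
      (𝓝 (∑ τ : Equiv.Perm (Fin n), x fun i => e (τ i))) :=
    tendsto_finsetSum _ fun τ _ => hx fun i => e (τ i)
  have hperm : ∀ N, ∑ τ : Equiv.Perm (Fin n), altSum (List.ofFn fun i => e (τ i) + 1) N =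
      permSum (fun l => altSum l N) (List.ofFn fun i => e i + 1) := fun N =>
    sum_perm_ofFn n (fun i => e i + 1) fun l => altSum l N
  simp only [hperm] at hsum
  refine ⟨ε * q, ?_⟩
  simp only [hz]
  rw [← mul_sum, tendsto_nhds_unique hsum hq, List.sum_ofFn, sum_add_distrib]
  simp [mul_add, mul_assoc]

theorem mainTheorem3 (r : ℕ) (hr : 0 < r) :
    (∀ e : Fin (2 * r) → ℕ,
      (∀ τ : Equiv.Perm (Fin (2 * r)),
        Tendsto (fun n : ℕ => harmonicStar n (comp2321 r fun i => e (τ i))) atTop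
          (𝓝 (zetaStar (comp2321 r fun i => e (τ i))))) ∧
      ∃ q : ℚ, ∑ τ : Equiv.Perm (Fin (2 * r)), zetaStar (comp2321 r fun i => e (τ i)) =
        (q : ℝ) * Real.pi ^ (2 * (∑ i, e i) + 4 * r)) ∧
    (∀ e : Fin (2 * r + 1) → ℕ,
      (∀ τ : Equiv.Perm (Fin (2 * r + 1)),
        Tendsto (fun n : ℕ => harmonicStar n (comp2321Tail r fun i => e (τ i))) atTop
          (𝓝 (zetaStar (comp2321Tail r fun i => e (τ i))))) ∧
      ∃ q : ℚ, ∑ τ : Equiv.Perm (Fin (2 * r + 1)), zetaStar (comp2321Tail r fun i => e (τ i)) =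
        (q : ℝ) * Real.pi ^ (2 * (∑ i, e i) + 4 * r + 2)) := by
  have hpos : ∀ {n : ℕ} {c : Fin n → ℕ}, ∀ a ∈ List.ofFn fun i => c i + 1, 1 ≤ a :=
    one_le_of_mem_ofFn_add_one
  refine ⟨fun e => ⟨fun τ => (hasStarExpansion_comp2321 hr _).tendsto_zetaStar hpos, ?_⟩,
    fun e => ⟨fun τ => (hasStarExpansion_comp2321Tail hr _).tendsto_zetaStar hpos, ?_⟩⟩
  · have h := exists_rat_sum_perm_zetaStar (ε := 1)
      (fun c => by simpa using hasStarExpansion_comp2321 hr c) e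
    rwa [show 2 * (2 * r) = 4 * r by ring] at h
  · have h := exists_rat_sum_perm_zetaStar (ε := -1)
      (fun c => by simpa using hasStarExpansion_comp2321Tail hr c) e
    rwa [show 2 * (∑ i, e i) + 2 * (2 * r + 1) = 2 * (∑ i, e i) + 4 * r + 2 by ring] at h
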